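/- Let $Q$ be an $n$-dimensional (real, Hausdorff, second countable, $C^\infty$) manifold, let $k\ge 1$, and let $M=T^{(k-1)}Q$ be its tangent bundle of order $k-1$, i.e. the manifold of classes of smooth curves $\gamma$ in $Q$ modulo contact of order $k-1$ at $0$; a chart $(q^i)$ of $Q$ induces the natural coordinates $q^i_{(j)}([\gamma])=\frac{d^j}{dt^j}\big|_{0}(q^i\circ\gamma)$, $0\le j\le k-1$, on $M$, $(q^i_{(j)};v^i_{(j)})$ on $TM$ and $(q^i_{(j)};p_i^{(j)})$ on $T^*M$. Let $\theta$ be the Liouville $1$-form on $T^*M$, $\theta_\alpha(X)=\alpha(T\pi(X))$ with $\pi:T^*M\to M$ the projection, and $\omega=-d\theta$ the canonical symplectic form. For smooth $H:T^*M\to\mathbb R$ and $L:TM\to\mathbb R$ let $\mathcal FH:T^*M\to TM$ and $\mathcal FL:TM\to T^*M$ be the fiber derivatives (the derivatives along the fibers, with $T_x^{**}M\cong T_xM$); $H$, respectively $L$, is called hyperregular if $\mathcal FH$, respectively $\mathcal FL$, is a global diffeomorphism. Let $H\in C^\infty(T^*M)$ be hyperregular. Then there is a unique smooth vector field $X_H$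 on $T^*M$ with $i_{X_H}\omega=dH$, and the function $$L=\theta(X_H)\circ\mathcal FH^{-1}-H\circ\mathcal FH^{-1}:TM\to\mathbb R$$ is smooth and hyperregular, with $\mathcal FL=\mathcal FH^{-1}$. Moreover, in all natural coordinates, $$L\big(q^i_{(j)};v^i_{(j)}\big)=\sum_{j=0}^{k-1}\sum_{i=1}^n\tilde p_i^{(j)}\,v^i_{(j)}-H\big(q^i_{(j)};\tilde p_i^{(j)}\big),\qquad \tilde p_i^{(j)}=(\mathcal FH^{-1})^*p_i^{(j)}=p_i^{(j)}\circ\mathcal FH^{-1},$$ and $L$ is the only function on $TM$ with these local expressions. -/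

import Mathlib

open scoped Manifold ContDiff Topology
open Set Filter

set_option linter.unusedSectionVars false

noncomputable section
namespace HigherOrderMechanics

theorem iteratedDeriv_comp_congr {E F : Type*} [NormedAddCommGroup E] [NormedSpace ℝ E]
    [NormedAddCommGroup F] [NormedSpace ℝ F] {g : E → F} {u v : ℝ → E} {k : ℕ}
    (hg : ContDiffAt ℝ ∞ g (u 0)) (hu : ContDiffAt ℝ ∞ u 0) (hv : ContDiffAt ℝ ∞ v 0)
    (h : ∀ j ≤ k, iteratedDeriv j u 0 = iteratedDeriv j v 0) :
    ∀ j ≤ k, iteratedDeriv j (g ∘ u) 0 = iteratedDeriv j (g ∘ v) 0 := by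
  intro j hj
  have h0 : u 0 = v 0 := by simpa using h 0 (Nat.zero_le _)
  have h1 : ∀ i ≤ k, iteratedFDeriv ℝ i u 0 = iteratedFDeriv ℝ i v 0 := by
    intro i hi
    simp only [iteratedFDeriv_eq_equiv_comp, Function.comp_apply, h i hi]
  have hji : ((j : ℕ) : WithTop ℕ∞) ≤ (∞ : WithTop ℕ∞) := by exact_mod_cast le_top
  have h2 : iteratedFDeriv ℝ j (g ∘ u) 0 = iteratedFDeriv ℝ j (g ∘ v) 0 := by
    rw [iteratedFDeriv_comp hg hu hji, iteratedFDeriv_comp (h0 ▸ hg) hv hji, h0]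
    unfold FormalMultilinearSeries.taylorComp
    refine Finset.sum_congr rfl fun c _ => ?_
    have h3 : ∀ m, ftaylorSeries ℝ u 0 (c.partSize m) = ftaylorSeries ℝ v 0 (c.partSize m) :=
      fun m => h1 _ ((c.partSize_le m).trans hj)
    unfold FormalMultilinearSeries.compAlongOrderedFinpartition
    simp only [h3]
  simp only [iteratedDeriv_eq_iteratedFDeriv, h2]

/-- The polynomial curve with prescribed derivatives `y 0, …, y k` at `0`. -/
def taylorCurve {E : Type*} [NormedAddCommGroup E] [NormedSpace ℝ E] {k : ℕ}
    (y : Fin (k + 1) → E) (t : ℝ) : E :=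
  ∑ j : Fin (k + 1), (t ^ (j : ℕ) / (Nat.factorial (j : ℕ) : ℝ)) • y j

section
variable {E : Type*} [NormedAddCommGroup E] [NormedSpace ℝ E] {k : ℕ}

theorem contDiff_taylorCurve_uncurry :
    ContDiff ℝ ∞ (fun p : (Fin (k + 1) → E) × ℝ => taylorCurve p.1 p.2) := by
  unfold taylorCurve
  fun_prop

theorem contDiff_taylorCurve (y : Fin (k + 1) → E) : ContDiff ℝ ∞ (taylorCurve y) := by
  unfold taylorCurve
  fun_prop

theorem taylorCurve_zero (y : Fin (k + 1) → E) : taylorCurve y 0 = y 0 := by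
  unfold taylorCurve
  rw [Finset.sum_eq_single 0]
  · simp
  · intro b _ hb
    have : (b : ℕ) ≠ 0 := fun h => hb (Fin.ext h)
    simp [this]
  · simp

theorem iteratedDeriv_taylorCurve (y : Fin (k + 1) → E) (j : Fin (k + 1)) :
    iteratedDeriv j (taylorCurve y) 0 = y j := by
  unfold taylorCurve
  have h : ∀ i : Fin (k + 1), iteratedDeriv j
      (fun t : ℝ => (t ^ (i : ℕ) / (Nat.factorial (i : ℕ) : ℝ)) • y i) 0 =
        if i = j then y i else 0 := by
    intro i
    rw [iteratedDeriv_smul_const (by fun_prop)]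
    simp only [div_eq_mul_inv, iteratedDeriv_mul_const_field, iteratedDeriv_fun_pow_zero]
    by_cases hij : i = j
    · subst hij
      have : ((i : ℕ).factorial : ℝ) ≠ 0 := by positivity
      simp [this]
    · have h1 : (j : ℕ) ≠ (i : ℕ) := fun h => hij (Fin.ext h.symm)
      simp [hij, h1]
  rw [iteratedDeriv_fun_sum]
  · simp [h]
  · intro i _
    fun_prop

/-- Iterated derivatives in the parameter of a jointly smooth function depend smoothly on the
remaining variable. -/
theorem contDiffOn_iteratedDeriv_slice {P F : Type*} [NormedAddCommGroup P] [NormedSpace ℝ P]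
    [NormedAddCommGroup F] [NormedSpace ℝ F] {G : P × ℝ → F} {U : Set (P × ℝ)} (hU : IsOpen U)
    (hG : ContDiffOn ℝ ∞ G U) (j : ℕ) :
    ContDiffOn ℝ ∞ (fun p : P × ℝ => iteratedDeriv j (fun t => G (p.1, t)) p.2) U := by
  induction j with
  | zero => simpa using hG
  | succ j ih =>
    have h := (ih.fderiv_of_isOpen hU (m := ∞) (by simp)).clm_apply
      (contDiffOn_const (c := ((0 : P), (1 : ℝ))))
    refine h.congr ?_
    intro p hp
    have hd := ((ih.contDiffAt (hU.mem_nhds hp)).differentiableAt (by simp)).hasFDerivAt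
    have hc : HasDerivAt (fun t : ℝ => (p.1, t)) ((0 : P), (1 : ℝ)) p.2 :=
      (hasDerivAt_const _ _).prodMk (hasDerivAt_id _)
    rw [iteratedDeriv_succ]
    exact (hd.comp_hasDerivAt p.2 hc).deriv


variable (E) in
/-- Smooth curves in `Q` defined near `0` (values away from `0` are irrelevant). -/
def LocalCurve (Q : Type*) [TopologicalSpace Q] [ChartedSpace E Q] : Type _ :=
  {γ : ℝ → Q // ∀ᶠ t in 𝓝 (0 : ℝ), ContMDiffAt 𝓘(ℝ, ℝ) 𝓘(ℝ, E) ∞ γ t}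

/-- Two curves have contact of order `k` at `0`: they agree at `0` and, in some chart around the
common point, their derivatives at `0` agree up to order `k`. -/
def HasContact (E : Type*) [NormedAddCommGroup E] [NormedSpace ℝ E] (k : ℕ)
    {Q : Type*} [TopologicalSpace Q] [ChartedSpace E Q] (γ₁ γ₂ : ℝ → Q) : Prop :=
  γ₁ 0 = γ₂ 0 ∧ ∃ φ ∈ IsManifold.maximalAtlas 𝓘(ℝ, E) ∞ Q, γ₁ 0 ∈ φ.source ∧
    ∀ j ≤ k, iteratedDeriv j (φ ∘ γ₁) 0 = iteratedDeriv j (φ ∘ γ₂) 0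

variable {Q : Type*} [TopologicalSpace Q] [ChartedSpace E Q]

theorem LocalCurve.contDiffAt_chart (γ : LocalCurve E Q) {φ : OpenPartialHomeomorph Q E}
    (hφ : φ ∈ IsManifold.maximalAtlas 𝓘(ℝ, E) ∞ Q) (h0 : γ.1 0 ∈ φ.source) :
    ContDiffAt ℝ ∞ (φ ∘ γ.1) 0 :=
  contMDiffAt_iff_contDiffAt.1
    ((contMDiffAt_of_mem_maximalAtlas hφ h0).comp 0 γ.2.self_of_nhds)

theorem contDiffOn_transition {φ ψ : OpenPartialHomeomorph Q E}
    (hφ : φ ∈ IsManifold.maximalAtlas 𝓘(ℝ, E) ∞ Q)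
    (hψ : ψ ∈ IsManifold.maximalAtlas 𝓘(ℝ, E) ∞ Q) :
    ContDiffOn ℝ ∞ (ψ ∘ φ.symm) (φ.symm ≫ₕ ψ).source := by
  rw [← contMDiffOn_iff_contDiffOn]
  refine (contMDiffOn_of_mem_maximalAtlas hψ).comp
    ((contMDiffOn_symm_of_mem_maximalAtlas hφ).mono ?_) ?_
  · intro x hx; simp at hx; exact hx.1
  · intro x hx; simp at hx; exact hx.2

/-- Contact may be tested in any chart around the base point. -/
theorem HasContact.in_chart {γ₁ γ₂ : LocalCurve E Q} (h : HasContact E k γ₁.1 γ₂.1)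
    {ψ : OpenPartialHomeomorph Q E} (hψ : ψ ∈ IsManifold.maximalAtlas 𝓘(ℝ, E) ∞ Q)
    (h0 : γ₁.1 0 ∈ ψ.source) :
    ∀ j ≤ k, iteratedDeriv j (ψ ∘ γ₁.1) 0 = iteratedDeriv j (ψ ∘ γ₂.1) 0 := by
  obtain ⟨he, φ, hφ, hφ0, h⟩ := h
  have key : ∀ γ : LocalCurve E Q, γ.1 0 ∈ φ.source →
      (ψ ∘ γ.1) =ᶠ[𝓝 0] (ψ ∘ φ.symm) ∘ (φ ∘ γ.1) := by
    intro γ hγ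
    have hc : ContinuousAt γ.1 0 := γ.2.self_of_nhds.continuousAt
    filter_upwards [hc.preimage_mem_nhds (φ.open_source.mem_nhds hγ)] with t ht
    simp [φ.left_inv ht]
  intro j hj
  rw [(key γ₁ hφ0).iteratedDeriv_eq, (key γ₂ (he ▸ hφ0)).iteratedDeriv_eq]
  refine iteratedDeriv_comp_congr (k := k) ?_ (γ₁.contDiffAt_chart hφ hφ0)
    (γ₂.contDiffAt_chart hφ (he ▸ hφ0)) h j hj
  refine (contDiffOn_transition hφ hψ).contDiffAt ((φ.symm ≫ₕ ψ).open_source.mem_nhds ?_)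
  simp [hφ0, h0]

variable [IsManifold 𝓘(ℝ, E) ∞ Q]

variable (E k Q) in
/-- Contact of order `k` at `0` as an equivalence relation on smooth curves. -/
def contactSetoid : Setoid (LocalCurve E Q) where
  r γ₁ γ₂ := HasContact E k γ₁.1 γ₂.1
  iseqv :=
    { refl := fun γ => ⟨rfl, chartAt E (γ.1 0), IsManifold.chart_mem_maximalAtlas _,
        mem_chart_source E _, fun _ _ => rfl⟩
      symm := fun ⟨h, φ, hφ, h0, h1⟩ => ⟨h.symm, φ, hφ, h ▸ h0, fun j hj => (h1 j hj).symm⟩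
      trans := fun {γ₁ _ _} h h' => ⟨h.1.trans h'.1, chartAt E (γ₁.1 0),
        IsManifold.chart_mem_maximalAtlas _, mem_chart_source E _, fun j hj =>
          (h.in_chart (IsManifold.chart_mem_maximalAtlas _) (mem_chart_source E _) j hj).trans
            (h'.in_chart (IsManifold.chart_mem_maximalAtlas _)
              (h.1 ▸ mem_chart_source E _) j hj)⟩ }

variable (E k Q) in
/-- The `k`-th order tangent bundle `T^{(k)}Q`: classes `[γ]₀^{(k)}` of smooth curves modulo
contact of order `k` at `0`. -/
def HigherTangent : Type _ := Quotient (contactSetoid E k Q)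

namespace HigherTangent

/-- The class `[γ]₀^{(k)}`. -/
def mk (k : ℕ) (γ : LocalCurve E Q) : HigherTangent E k Q := Quotient.mk (contactSetoid E k Q) γ

theorem mk_surjective (x : HigherTangent E k Q) : ∃ γ : LocalCurve E Q, mk k γ = x :=
  Quotient.exists_rep x

/-- The projection `[γ]₀^{(k)} ↦ γ 0`. -/
def base : HigherTangent E k Q → Q :=
  Quotient.lift (fun γ : LocalCurve E Q => γ.1 0) fun _ _ h => h.1

/-- The natural coordinates `q_{(j)} = (d/dt)^j (φ ∘ γ) (0)`, `0 ≤ j ≤ k`, induced by a chart `φ` of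
`Q` (they depend only on the class of `γ` when `γ 0` is in the domain of `φ`). -/
def coord (φ : OpenPartialHomeomorph Q E) (x : HigherTangent E k Q) (j : Fin (k + 1)) : E :=
  iteratedDeriv j (φ ∘ (Quotient.out x).1) 0

theorem coord_mk {φ : OpenPartialHomeomorph Q E}
    (hφ : φ ∈ IsManifold.maximalAtlas 𝓘(ℝ, E) ∞ Q) (γ : LocalCurve E Q)
    (h0 : γ.1 0 ∈ φ.source) (j : Fin (k + 1)) :
    coord φ (mk k γ) j = iteratedDeriv j (φ ∘ γ.1) 0 := by
  have h : HasContact E k (Quotient.out (mk k γ)).1 γ.1 :=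
    Quotient.exact (s := contactSetoid E k Q) (Quotient.out_eq (mk k γ))
  exact h.in_chart hφ (h.1 ▸ h0) j (Nat.lt_succ_iff.1 j.2)

theorem mk_eq_of_coord {φ : OpenPartialHomeomorph Q E}
    (hφ : φ ∈ IsManifold.maximalAtlas 𝓘(ℝ, E) ∞ Q) {γ₁ γ₂ : LocalCurve E Q}
    (h₁ : γ₁.1 0 ∈ φ.source) (h₂ : γ₂.1 0 ∈ φ.source)
    (h : ∀ j : Fin (k + 1), iteratedDeriv j (φ ∘ γ₁.1) 0 = iteratedDeriv j (φ ∘ γ₂.1) 0) :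
    mk k γ₁ = mk k γ₂ := by
  refine Quotient.sound (s := contactSetoid E k Q) ⟨?_, φ, hφ, h₁, fun j hj =>
    h ⟨j, Nat.lt_succ_of_le hj⟩⟩
  refine φ.injOn h₁ h₂ ?_
  simpa using h 0

open Classical in
/-- The curve `φ⁻¹ (Σ t^j/j! y_j)`, defined near `0` when `y 0` is in the target of `φ`. -/
def chartCurve (φ : OpenPartialHomeomorph Q E)
    (hφ : φ ∈ IsManifold.maximalAtlas 𝓘(ℝ, E) ∞ Q) (y : Fin (k + 1) → E) : LocalCurve E Q :=
  ⟨if y 0 ∈ φ.target then φ.symm ∘ taylorCurve y else fun _ => φ.symm (y 0), by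
    split_ifs with h
    · have hc : ContinuousAt (taylorCurve y) 0 := (contDiff_taylorCurve y).continuous.continuousAt
      rw [← taylorCurve_zero y] at h
      filter_upwards [hc.preimage_mem_nhds (φ.open_target.mem_nhds h)] with t ht
      exact (contMDiffAt_symm_of_mem_maximalAtlas hφ ht).comp t
        (contDiff_taylorCurve y).contDiffAt.contMDiffAt
    · exact Eventually.of_forall fun t => contMDiffAt_const⟩

theorem chartCurve_val {φ : OpenPartialHomeomorph Q E}
    (hφ : φ ∈ IsManifold.maximalAtlas 𝓘(ℝ, E) ∞ Q) {y : Fin (k + 1) → E} (h : y 0 ∈ φ.target) :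
    (chartCurve φ hφ y).1 = φ.symm ∘ taylorCurve y := by
  simp [chartCurve, h]

theorem chartCurve_mem {φ : OpenPartialHomeomorph Q E}
    (hφ : φ ∈ IsManifold.maximalAtlas 𝓘(ℝ, E) ∞ Q) {y : Fin (k + 1) → E} (h : y 0 ∈ φ.target) :
    (chartCurve φ hφ y).1 0 ∈ φ.source := by
  rw [chartCurve_val hφ h, Function.comp_apply, taylorCurve_zero]
  exact φ.map_target h

theorem coord_chartCurve {φ : OpenPartialHomeomorph Q E}
    (hφ : φ ∈ IsManifold.maximalAtlas 𝓘(ℝ, E) ∞ Q) {y : Fin (k + 1) → E} (h : y 0 ∈ φ.target)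
    (j : Fin (k + 1)) : coord φ (mk k (chartCurve φ hφ y)) j = y j := by
  rw [coord_mk hφ _ (chartCurve_mem hφ h), chartCurve_val hφ h]
  have he : (φ ∘ φ.symm ∘ taylorCurve y) =ᶠ[𝓝 0] taylorCurve y := by
    have hc : ContinuousAt (taylorCurve y) 0 := (contDiff_taylorCurve y).continuous.continuousAt
    rw [← taylorCurve_zero y] at h
    filter_upwards [hc.preimage_mem_nhds (φ.open_target.mem_nhds h)] with t ht
    exact φ.right_inv ht
  rw [he.iteratedDeriv_eq, iteratedDeriv_taylorCurve]

/-- The chart of `T^{(k)}Q` induced by a chart `φ` of `Q`, with the natural coordinates. -/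
def chart (k : ℕ) (φ : OpenPartialHomeomorph Q E)
    (hφ : φ ∈ IsManifold.maximalAtlas 𝓘(ℝ, E) ∞ Q) :
    PartialEquiv (HigherTangent E k Q) (Fin (k + 1) → E) where
  toFun := coord φ
  invFun y := mk k (chartCurve φ hφ y)
  source := {x | base x ∈ φ.source}
  target := {y | y 0 ∈ φ.target}
  map_source' x hx := by
    obtain ⟨γ, rfl⟩ := mk_surjective x
    change coord φ (mk k γ) 0 ∈ φ.target
    have hx' : γ.1 0 ∈ φ.source := hx
    rw [coord_mk hφ γ hx']
    simpa using φ.map_source hx'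
  map_target' y hy := chartCurve_mem hφ (y := y) hy
  left_inv' x hx := by
    obtain ⟨γ, rfl⟩ := mk_surjective x
    have hx' : γ.1 0 ∈ φ.source := hx
    have hy : coord φ (mk k γ) 0 ∈ φ.target := by
      rw [coord_mk hφ γ hx']
      simpa using φ.map_source hx'
    refine mk_eq_of_coord hφ (chartCurve_mem hφ hy) hx' fun j => ?_
    rw [← coord_mk hφ _ (chartCurve_mem hφ hy), ← coord_mk hφ γ hx', coord_chartCurve hφ hy]
  right_inv' y hy := funext fun j => coord_chartCurve hφ hy j

theorem chart_transition_source {φ ψ : OpenPartialHomeomorph Q E}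
    (hφ : φ ∈ IsManifold.maximalAtlas 𝓘(ℝ, E) ∞ Q)
    (hψ : ψ ∈ IsManifold.maximalAtlas 𝓘(ℝ, E) ∞ Q) :
    ((chart k φ hφ).symm.trans (chart k ψ hψ)).source =
      (fun y : Fin (k + 1) → E => y 0) ⁻¹' (φ.symm ≫ₕ ψ).source := by
  ext y
  simp only [PartialEquiv.trans_source, PartialEquiv.symm_source, mem_inter_iff, mem_preimage,
    OpenPartialHomeomorph.trans_source, OpenPartialHomeomorph.symm_source]
  refine and_congr_right fun hy => ?_
  have hy' : y 0 ∈ φ.target := hy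
  change (chartCurve φ hφ y).1 0 ∈ ψ.source ↔ _
  rw [chartCurve_val hφ hy', Function.comp_apply, taylorCurve_zero]

theorem contDiffOn_chart_transition {φ ψ : OpenPartialHomeomorph Q E}
    (hφ : φ ∈ IsManifold.maximalAtlas 𝓘(ℝ, E) ∞ Q)
    (hψ : ψ ∈ IsManifold.maximalAtlas 𝓘(ℝ, E) ∞ Q) :
    ContDiffOn ℝ ∞ ((chart k φ hφ).symm.trans (chart k ψ hψ))
      ((chart k φ hφ).symm.trans (chart k ψ hψ)).source := by
  rw [chart_transition_source hφ hψ, contDiffOn_pi]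
  intro j
  have hU : IsOpen ((fun p : (Fin (k + 1) → E) × ℝ => taylorCurve p.1 p.2) ⁻¹'
      (φ.symm ≫ₕ ψ).source) :=
    (φ.symm ≫ₕ ψ).open_source.preimage contDiff_taylorCurve_uncurry.continuous
  have hG : ContDiffOn ℝ ∞ ((ψ ∘ φ.symm) ∘ fun p : (Fin (k + 1) → E) × ℝ => taylorCurve p.1 p.2)
      ((fun p : (Fin (k + 1) → E) × ℝ => taylorCurve p.1 p.2) ⁻¹' (φ.symm ≫ₕ ψ).source) :=
    (contDiffOn_transition hφ hψ).comp contDiff_taylorCurve_uncurry.contDiffOn fun _ h => h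
  refine ((contDiffOn_iteratedDeriv_slice hU hG j).comp
    (g := fun p : (Fin (k + 1) → E) × ℝ => iteratedDeriv j
      (fun t => ((ψ ∘ φ.symm) ∘ fun p : (Fin (k + 1) → E) × ℝ => taylorCurve p.1 p.2) (p.1, t)) p.2)
    (f := fun y : Fin (k + 1) → E => (y, (0 : ℝ))) (by fun_prop) ?_).congr ?_
  · intro y hy
    simpa [taylorCurve_zero] using hy
  · intro y hy
    have hy1 : y 0 ∈ φ.target := hy.1
    have hy2 : (chartCurve φ hφ y).1 0 ∈ ψ.source := by
      rw [chartCurve_val hφ hy1, Function.comp_apply, taylorCurve_zero]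
      exact hy.2
    change coord ψ (mk k (chartCurve φ hφ y)) j = _
    rw [coord_mk hψ _ hy2, chartCurve_val hφ hy1]
    rfl

variable (E k Q) in
/-- The natural charts of `T^{(k)}Q` induced by all charts of the smooth manifold `Q`. -/
def core : ChartedSpaceCore (Fin (k + 1) → E) (HigherTangent E k Q) where
  atlas := {e | ∃ (φ : OpenPartialHomeomorph Q E)
    (hφ : φ ∈ IsManifold.maximalAtlas 𝓘(ℝ, E) ∞ Q), e = chart k φ hφ}
  chartAt x := chart k (chartAt E (base x)) (IsManifold.chart_mem_maximalAtlas _)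
  mem_chart_source x := mem_chart_source E (base x)
  chart_mem_atlas x := ⟨_, _, rfl⟩
  open_source := by
    rintro _ _ ⟨φ, hφ, rfl⟩ ⟨ψ, hψ, rfl⟩
    rw [chart_transition_source hφ hψ]
    exact (φ.symm ≫ₕ ψ).open_source.preimage (continuous_apply 0)
  continuousOn_toFun := by
    rintro _ _ ⟨φ, hφ, rfl⟩ ⟨ψ, hψ, rfl⟩
    exact (contDiffOn_chart_transition hφ hψ).continuousOn

instance : TopologicalSpace (HigherTangent E k Q) := (core E k Q).toTopologicalSpace

instance : ChartedSpace (Fin (k + 1) → E) (HigherTangent E k Q) := (core E k Q).toChartedSpace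

instance : IsManifold 𝓘(ℝ, Fin (k + 1) → E) ∞ (HigherTangent E k Q) := by
  refine isManifold_of_contDiffOn _ _ _ ?_
  intro e e' he he'
  obtain ⟨_, ⟨_, rfl⟩, _, ⟨⟨φ, hφ, rfl⟩, rfl⟩, rfl⟩ := he
  obtain ⟨_, ⟨_, rfl⟩, _, ⟨⟨ψ, hψ, rfl⟩, rfl⟩, rfl⟩ := he'
  simpa using! contDiffOn_chart_transition hφ hψ

end HigherTangent
end

/-! ### Tangent and cotangent bundles, the canonical symplectic form -/

section
variable {E : Type*} [NormedAddCommGroup E] [NormedSpace ℝ E]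

/-- The cotangent space `T*_x M`. -/
abbrev CotangentSpace (E : Type*) [NormedAddCommGroup E] [NormedSpace ℝ E] {M : Type*}
    [TopologicalSpace M] [ChartedSpace E M] (x : M) : Type _ := TangentSpace 𝓘(ℝ, E) x →L[ℝ] ℝ

/-- The cotangent bundle `T*M`, as the bundle of continuous linear maps from `TM` to the trivial
line bundle, with the topology and smooth structure that Mathlib puts on such a bundle. -/
abbrev CotangentBundle (E : Type*) [NormedAddCommGroup E] [NormedSpace ℝ E] (M : Type*)
    [TopologicalSpace M] [ChartedSpace E M] : Type _ :=
  Bundle.TotalSpace (E →L[ℝ] ℝ) (fun x : M => TangentSpace 𝓘(ℝ, E) x →L[ℝ] ℝ)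

/-- The model of `TM`. -/
abbrev tanModel (E : Type*) [NormedAddCommGroup E] [NormedSpace ℝ E] :
    ModelWithCorners ℝ (E × E) (ModelProd E E) := 𝓘(ℝ, E).prod 𝓘(ℝ, E)

/-- The model of `T*M`. -/
abbrev cotModel (E : Type*) [NormedAddCommGroup E] [NormedSpace ℝ E] :
    ModelWithCorners ℝ (E × (E →L[ℝ] ℝ)) (ModelProd E (E →L[ℝ] ℝ)) :=
  𝓘(ℝ, E).prod 𝓘(ℝ, E →L[ℝ] ℝ)

section OneForms
variable {F : Type*} [NormedAddCommGroup F] [NormedSpace ℝ F] {K : Type*} [TopologicalSpace K]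
  {I : ModelWithCorners ℝ F K} {N : Type*} [TopologicalSpace N] [ChartedSpace K N]

/-- The local representative of a `1`-form `θ` in the preferred chart `φ` at `x₀`, that is the
pull-back `(φ⁻¹)^*θ`, a `1`-form on (an open subset of) the model vector space. -/
def oneFormInChart (θ : ∀ x : N, TangentSpace I x →L[ℝ] ℝ) (x₀ : N) (y : F) : F →L[ℝ] ℝ :=
  (θ ((extChartAt I x₀).symm y)).comp (mfderiv 𝓘(ℝ, F) I (extChartAt I x₀).symm y)

/-- The exterior derivative `dθ` of a `1`-form on a manifold, `(dθ)_x(u, v) = D_u θ(v) - D_v θ(u)`,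
computed in the preferred chart at `x`. -/
def extDerivOneForm (θ : ∀ x : N, TangentSpace I x →L[ℝ] ℝ) (x : N)
    (u v : TangentSpace I x) : ℝ :=
  let D : F →L[ℝ] F →L[ℝ] ℝ := fderiv ℝ (oneFormInChart θ x) (extChartAt I x x)
  let u' : F := mfderiv I 𝓘(ℝ, F) (extChartAt I x) x u
  let v' : F := mfderiv I 𝓘(ℝ, F) (extChartAt I x) x v
  D u' v' - D v' u'

end OneForms

variable {M : Type*} [TopologicalSpace M] [ChartedSpace E M] [IsManifold 𝓘(ℝ, E) ∞ M]

/-- The Liouville `1`-form `θ` of `T*M`: `θ_α(X) = α(Tπ(X))`. -/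
def liouvilleForm (α : CotangentBundle E M) : TangentSpace (cotModel E) α →L[ℝ] ℝ :=
  α.2.comp (mfderiv (cotModel E) 𝓘(ℝ, E)
    (Bundle.TotalSpace.proj : CotangentBundle E M → M) α)

/-- The canonical symplectic form `ω = -dθ` of `T*M`. -/
def canonicalSymplecticForm (α : CotangentBundle E M) (u v : TangentSpace (cotModel E) α) : ℝ :=
  -extDerivOneForm (I := cotModel E) (liouvilleForm (E := E) (M := M)) α u v

/-- `X` is a smooth vector field on `T*M` with `i_X ω = dH`. -/
def IsHamiltonianVectorField (H : CotangentBundle E M → ℝ)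
    (X : ∀ α : CotangentBundle E M, TangentSpace (cotModel E) α) : Prop :=
  ContMDiff (cotModel E) (cotModel E).tangent ∞
      (fun α => (⟨α, X α⟩ : TangentBundle (cotModel E) (CotangentBundle E M))) ∧
    ∀ (α : CotangentBundle E M) (w : TangentSpace (cotModel E) α),
      canonicalSymplecticForm α (X α) w = mfderiv (cotModel E) 𝓘(ℝ, ℝ) H α w

/-! ### Fiber derivatives and hyperregularity -/

/-- The fiber derivative `𝓕L : TM → T*M` of a function on `TM`. -/
def fiberDerivLagrangian (L : TangentBundle 𝓘(ℝ, E) M → ℝ) (v : TangentBundle 𝓘(ℝ, E) M) :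
    CotangentBundle E M :=
  ⟨v.1, fderiv ℝ (fun w : TangentSpace 𝓘(ℝ, E) v.1 => L ⟨v.1, w⟩) v.2⟩

/-- A smooth function on `TM` is hyperregular if its fiber derivative is a diffeomorphism. -/
def IsHyperregularLagrangian (L : TangentBundle 𝓘(ℝ, E) M → ℝ) : Prop :=
  ContMDiff (tanModel E) 𝓘(ℝ, ℝ) ∞ L ∧
    ∃ Ψ : TangentBundle 𝓘(ℝ, E) M ≃ₘ^∞⟮tanModel E, cotModel E⟯ CotangentBundle E M,
      ⇑Ψ = fiberDerivLagrangian L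

/-- The tangent vector at `x` whose image under the tangent map of the chart `c` at `x` is `e`. -/
def vectorOfChart (c : M → E) (x : M) (e : E) : TangentSpace 𝓘(ℝ, E) x :=
  (mfderiv 𝓘(ℝ, E) 𝓘(ℝ, E) c x).inverse e

variable [FiniteDimensional ℝ E]

instance instT2SpaceTangentSpace (x : M) : T2Space (TangentSpace 𝓘(ℝ, E) x) :=
  inferInstanceAs (T2Space E)

instance instFiniteDimensionalTangentSpace (x : M) :
    FiniteDimensional ℝ (TangentSpace 𝓘(ℝ, E) x) :=
  inferInstanceAs (FiniteDimensional ℝ E)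

/-- The canonical isomorphism `(V*)* ≅ V` of a finite-dimensional space, for continuous duals. -/
def ofBidual {V : Type*} [AddCommGroup V] [Module ℝ V] [TopologicalSpace V]
    [IsTopologicalAddGroup V] [ContinuousSMul ℝ V] [T2Space V] [FiniteDimensional ℝ V]
    (D : (V →L[ℝ] ℝ) →L[ℝ] ℝ) : V :=
  (Module.evalEquiv ℝ V).symm
    ((D : (V →L[ℝ] ℝ) →ₗ[ℝ] ℝ) ∘ₗ
      (LinearMap.toContinuousLinearMap : (V →ₗ[ℝ] ℝ) ≃ₗ[ℝ] (V →L[ℝ] ℝ)).toLinearMap)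

theorem apply_ofBidual {V : Type*} [AddCommGroup V] [Module ℝ V] [TopologicalSpace V]
    [IsTopologicalAddGroup V] [ContinuousSMul ℝ V] [T2Space V] [FiniteDimensional ℝ V]
    (D : (V →L[ℝ] ℝ) →L[ℝ] ℝ) (β : V →L[ℝ] ℝ) : β (ofBidual D) = D β := by
  unfold ofBidual
  have h := Module.apply_evalEquiv_symm_apply (R := ℝ) (M := V) (β : V →ₗ[ℝ] ℝ)
    ((D : (V →L[ℝ] ℝ) →ₗ[ℝ] ℝ) ∘ₗ
      (LinearMap.toContinuousLinearMap : (V →ₗ[ℝ] ℝ) ≃ₗ[ℝ] (V →L[ℝ] ℝ)).toLinearMap)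
  exact h.trans rfl

/-- The fiber derivative `𝓕H : T*M → TM` of a function on `T*M`, using `(T*_x M)* ≅ T_x M`. -/
def fiberDerivHamiltonian (H : CotangentBundle E M → ℝ) (α : CotangentBundle E M) :
    TangentBundle 𝓘(ℝ, E) M :=
  ⟨α.1, ofBidual (fderiv ℝ (fun β : CotangentSpace E α.1 => H ⟨α.1, β⟩) α.2)⟩

/-- A smooth function on `T*M` is hyperregular if its fiber derivative is a diffeomorphism. -/
def IsHyperregularHamiltonian (H : CotangentBundle E M → ℝ) : Prop :=
  ContMDiff (cotModel E) 𝓘(ℝ, ℝ) ∞ H ∧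
    ∃ Φ : CotangentBundle E M ≃ₘ^∞⟮cotModel E, tanModel E⟯ TangentBundle 𝓘(ℝ, E) M,
      ⇑Φ = fiberDerivHamiltonian H

/-- The inverse `𝓕H⁻¹ : TM → T*M` of the fiber derivative of a hyperregular function. -/
def IsHyperregularHamiltonian.fiberDerivInv {H : CotangentBundle E M → ℝ}
    (hH : IsHyperregularHamiltonian H) : TangentBundle 𝓘(ℝ, E) M → CotangentBundle E M :=
  hH.2.choose.symm

theorem IsHyperregularHamiltonian.fiberDeriv_inv {H : CotangentBundle E M → ℝ}
    (hH : IsHyperregularHamiltonian H) (v : TangentBundle 𝓘(ℝ, E) M) :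
    fiberDerivHamiltonian H (hH.fiberDerivInv v) = v := by
  rw [← hH.2.choose_spec]
  exact hH.2.choose.apply_symm_apply v

theorem IsHyperregularHamiltonian.inv_fiberDeriv {H : CotangentBundle E M → ℝ}
    (hH : IsHyperregularHamiltonian H) (α : CotangentBundle E M) :
    hH.fiberDerivInv (fiberDerivHamiltonian H α) = α := by
  rw [← hH.2.choose_spec]
  exact hH.2.choose.symm_apply_apply α

/-- The function `L = θ(X) ∘ 𝓕H⁻¹ - H ∘ 𝓕H⁻¹` on `TM`. -/
def IsHyperregularHamiltonian.lagrangian {H : CotangentBundle E M → ℝ}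
    (hH : IsHyperregularHamiltonian H)
    (X : ∀ α : CotangentBundle E M, TangentSpace (cotModel E) α)
    (v : TangentBundle 𝓘(ℝ, E) M) : ℝ :=
  liouvilleForm (hH.fiberDerivInv v) (X (hH.fiberDerivInv v)) - H (hH.fiberDerivInv v)

end

/-! ### Natural coordinates on `T T^{(r)}Q` and `T* T^{(r)}Q` -/

section
variable {n r : ℕ} {Q : Type*} [TopologicalSpace Q] [ChartedSpace (EuclideanSpace ℝ (Fin n)) Q]
  [IsManifold (𝓡 n) ∞ Q]

/-- The model space of `T^{(r)}Q` for an `n`-dimensional `Q`. -/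
abbrev JetModel (n r : ℕ) : Type := Fin (r + 1) → EuclideanSpace ℝ (Fin n)

variable (n r Q) in
/-- `T^{(r)}Q` for an `n`-dimensional manifold `Q`. -/
abbrev HigherTangentBundle : Type _ := HigherTangent (EuclideanSpace ℝ (Fin n)) r Q

/-- The coordinate differential `dq^i_{(j)}` at `x`, for the natural coordinates induced by a chart
of `Q` around the base point of `x`. -/
def coordDifferential (φ : OpenPartialHomeomorph Q (EuclideanSpace ℝ (Fin n)))
    (x : HigherTangentBundle n r Q) (j : Fin (r + 1)) (i : Fin n) :
    CotangentSpace (JetModel n r) x :=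
  mfderiv 𝓘(ℝ, JetModel n r) 𝓘(ℝ, ℝ)
    (fun y : HigherTangentBundle n r Q => HigherTangent.coord φ y j i) x

/-- The coordinate vector `∂/∂q^i_{(j)}` at `x`, for the natural coordinates induced by a chart of
`Q` around the base point of `x`. -/
def coordVector (φ : OpenPartialHomeomorph Q (EuclideanSpace ℝ (Fin n)))
    (x : HigherTangentBundle n r Q) (j : Fin (r + 1)) (i : Fin n) :
    TangentSpace 𝓘(ℝ, JetModel n r) x :=
  vectorOfChart (HigherTangent.coord φ : HigherTangentBundle n r Q → JetModel n r) x
    (Pi.single j (EuclideanSpace.single i (1 : ℝ)))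

/-- The element of `T T^{(r)}Q` with natural coordinates `(q^i_{(j)}; v^i_{(j)})`. -/
def tangentOfCoords (φ : OpenPartialHomeomorph Q (EuclideanSpace ℝ (Fin n)))
    (hφ : φ ∈ IsManifold.maximalAtlas (𝓡 n) ∞ Q) (q : JetModel n r)
    (v : Fin (r + 1) → Fin n → ℝ) :
    TangentBundle 𝓘(ℝ, JetModel n r) (HigherTangentBundle n r Q) :=
  ⟨(HigherTangent.chart r φ hφ).symm q,
    ∑ j, ∑ i, v j i • coordVector φ ((HigherTangent.chart r φ hφ).symm q) j i⟩

/-- The element of `T* T^{(r)}Q` with natural coordinates `(q^i_{(j)}; p_i^{(j)})`. -/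
def cotangentOfCoords (φ : OpenPartialHomeomorph Q (EuclideanSpace ℝ (Fin n)))
    (hφ : φ ∈ IsManifold.maximalAtlas (𝓡 n) ∞ Q) (q : JetModel n r)
    (p : Fin (r + 1) → Fin n → ℝ) :
    CotangentBundle (JetModel n r) (HigherTangentBundle n r Q) :=
  ⟨(HigherTangent.chart r φ hφ).symm q,
    ∑ j, ∑ i, p j i • coordDifferential φ ((HigherTangent.chart r φ hφ).symm q) j i⟩

/-- The natural momentum coordinate functions `p_i^{(j)}` on `T* T^{(r)}Q`. -/
def momentum (φ : OpenPartialHomeomorph Q (EuclideanSpace ℝ (Fin n)))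
    (α : CotangentBundle (JetModel n r) (HigherTangentBundle n r Q)) (j : Fin (r + 1))
    (i : Fin n) : ℝ :=
  α.2 (coordVector φ α.1 j i)

/-- In all natural coordinates, `L(q; v) = p̃_i^{(j)} v^i_{(j)} - H(q; p̃)`, where
`p̃_i^{(j)} = p_i^{(j)} ∘ 𝓕H⁻¹`. -/
def HasLegendreLocalExpression
    {H : CotangentBundle (JetModel n r) (HigherTangentBundle n r Q) → ℝ}
    (hH : IsHyperregularHamiltonian H)
    (L : TangentBundle 𝓘(ℝ, JetModel n r) (HigherTangentBundle n r Q) → ℝ) : Prop :=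
  ∀ (φ : OpenPartialHomeomorph Q (EuclideanSpace ℝ (Fin n)))
    (hφ : φ ∈ IsManifold.maximalAtlas (𝓡 n) ∞ Q) (q : JetModel n r), q 0 ∈ φ.target →
    ∀ v : Fin (r + 1) → Fin n → ℝ,
      let p : Fin (r + 1) → Fin n → ℝ :=
        momentum φ (hH.fiberDerivInv (tangentOfCoords φ hφ q v))
      L (tangentOfCoords φ hφ q v) =
        (∑ j, ∑ i, p j i * v j i) - H (cotangentOfCoords φ hφ q p)

end

end HigherOrderMechanics

end

open HigherOrderMechanics

noncomputable section
namespace HigherOrderMechanics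

/-! ### Natural charts of `T*M` and the Liouville form as `p dq`. -/

section
variable {E : Type*} [NormedAddCommGroup E] [NormedSpace ℝ E]
  {M : Type*} [TopologicalSpace M] [ChartedSpace E M] [IsManifold 𝓘(ℝ, E) ∞ M]

/-! In a natural chart of `T*M` the Liouville form is `p dq` (`oneFormInChart_liouvilleForm`), so `ω
= dq ∧ dp`. This constant form is nondegenerate, hence `i_X ω = dH` has exactly one solution at each
point, `X = (∂H/∂p, -∂H/∂q)`. Since `extDerivOneForm` uses a different chart at each point,
smoothness of `X` requires `ω` to be `dq ∧ dp` in one fixed chart at all nearby points. This is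
`canonicalSymplecticForm_eq`: chart changes preserve `p dq`, hence also its exterior derivative.

The Liouville form pairs the momentum with the `q`-part of a vector, so `θ(X_H)` at `α` is `α(𝓕H α)`
(`liouvilleForm_hamiltonianVectorField`). With `𝓕H⁻¹(x, u) = (x, b u)` this makes `L(x, u) = b u u -
H(x, b u)`, the fiberwise Legendre transform. On differentiating in `u`, the terms containing `Db`
cancel because `∂H/∂p` at `b u` is `u`; what remains is `b u` (`fderiv_legendre`). So `𝓕L = 𝓕H⁻¹`, a
diffeomorphism.

The local expression expands this pairing in the dual bases `∂/∂q` and `dq`. It determines `L`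
because natural coordinates reach every tangent vector. -/

theorem cotangentChart_source (α : CotangentBundle E M) :
    (extChartAt (cotModel E) α).source = {β | β.1 ∈ (chartAt E α.1).source} := by
  ext β
  rw [FiberBundle.extChartAt]
  simp
  exact fun h => h

theorem cotangentChart_apply_fst (α β : CotangentBundle E M) :
    (extChartAt (cotModel E) α β).1 = extChartAt 𝓘(ℝ, E) α.1 β.1 := by
  rw [FiberBundle.extChartAt]
  rfl

theorem cotangentChart_apply_snd (α β : CotangentBundle E M) :
    (extChartAt (cotModel E) α β).2 =
      β.2.comp ((trivializationAt E (TangentSpace 𝓘(ℝ, E)) α.1).symmL ℝ β.1) := by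
  rw [FiberBundle.extChartAt]
  ext e
  simp [hom_trivializationAt_apply, ContinuousLinearMap.inCoordinates]

/-- The trivialization of `T*M` is dual to that of `TM`, and the latter acts on fibers by the
derivative of the base chart. Pairing in coordinates is therefore the intrinsic pairing. -/
theorem snd_apply_eq_cotangentChart {α β : CotangentBundle E M}
    (h : β.1 ∈ (chartAt E α.1).source) (w : TangentSpace 𝓘(ℝ, E) β.1) :
    β.2 w = (extChartAt (cotModel E) α β).2
      (mfderiv 𝓘(ℝ, E) 𝓘(ℝ, E) (extChartAt 𝓘(ℝ, E) α.1) β.1 w) := by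
  rw [cotangentChart_apply_snd, ← TangentBundle.continuousLinearMapAt_trivializationAt h]
  exact congrArg β.2 ((trivializationAt E (TangentSpace 𝓘(ℝ, E)) α.1).symmL_continuousLinearMapAt
    (R := ℝ) (b := β.1) h w).symm

theorem mdifferentiableAt_extChartAt_symm_of_boundaryless {F K N : Type*} [NormedAddCommGroup F]
    [NormedSpace ℝ F] [TopologicalSpace K] {I : ModelWithCorners ℝ F K} [I.Boundaryless]
    [TopologicalSpace N] [ChartedSpace K N] [IsManifold I 1 N] {x : N} {y : F}
    (hy : y ∈ (extChartAt I x).target) :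
    MDifferentiableAt 𝓘(ℝ, F) I (extChartAt I x).symm y := by
  have h := mdifferentiableWithinAt_extChartAt_symm hy
  rwa [I.range_eq_univ, mdifferentiableWithinAt_univ] at h

/-- The tangent map at `β` of the natural chart of `T*M` at `α`. -/
def cotangentChartDeriv (α β : CotangentBundle E M) :
    TangentSpace (cotModel E) β →L[ℝ] E × (E →L[ℝ] ℝ) :=
  mfderiv (cotModel E) 𝓘(ℝ, E × (E →L[ℝ] ℝ)) (extChartAt (cotModel E) α) β

theorem liouvilleForm_apply {α β : CotangentBundle E M} (h : β.1 ∈ (chartAt E α.1).source)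
    (w : TangentSpace (cotModel E) β) :
    liouvilleForm β w = (extChartAt (cotModel E) α β).2 (cotangentChartDeriv α β w).1 := by
  have hs : β ∈ (extChartAt (cotModel E) α).source := by rwa [cotangentChart_source]
  have hd : MDifferentiableAt (cotModel E) 𝓘(ℝ, E × (E →L[ℝ] ℝ)) (extChartAt (cotModel E) α) β :=
    mdifferentiableAt_extChartAt (by rwa [extChartAt_source] at hs)
  have hp : MDifferentiableAt (cotModel E) 𝓘(ℝ, E)
      (Bundle.TotalSpace.proj : CotangentBundle E M → M) β :=
    (Bundle.contMDiffAt_proj _ (n := 1)).mdifferentiableAt one_ne_zero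
  have hc : MDifferentiableAt 𝓘(ℝ, E) 𝓘(ℝ, E) (extChartAt 𝓘(ℝ, E) α.1) β.1 :=
    mdifferentiableAt_extChartAt h
  have h1 := mfderiv_comp β hc hp
  have hf : MDifferentiableAt 𝓘(ℝ, E × (E →L[ℝ] ℝ)) 𝓘(ℝ, E)
      (Prod.fst : E × (E →L[ℝ] ℝ) → E) (extChartAt (cotModel E) α β) :=
    differentiableAt_fst.mdifferentiableAt
  have h2 := mfderiv_comp β hf hd
  -- In coordinates `π` is the first projection, so two applications of the chain rule compute `Tπ`.
  have h3 : extChartAt 𝓘(ℝ, E) α.1 ∘ (Bundle.TotalSpace.proj : CotangentBundle E M → M) =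
      Prod.fst ∘ extChartAt (cotModel E) α :=
    funext fun γ => (cotangentChart_apply_fst α γ).symm
  rw [← h3, h1, mfderiv_eq_fderiv, fderiv_fst] at h2
  change β.2 (mfderiv (cotModel E) 𝓘(ℝ, E)
    (Bundle.TotalSpace.proj : CotangentBundle E M → M) β w) = _
  rw [snd_apply_eq_cotangentChart h]
  exact congrArg (extChartAt (cotModel E) α β).2 (DFunLike.congr_fun h2 w)

theorem mfderiv_extChartAt_mfderiv_symm_apply {F K N : Type*} [NormedAddCommGroup F]
    [NormedSpace ℝ F] [TopologicalSpace K] {I : ModelWithCorners ℝ F K} [I.Boundaryless]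
    [TopologicalSpace N] [ChartedSpace K N] [IsManifold I 1 N] {x : N} {y : F}
    (hy : y ∈ (extChartAt I x).target) (v : F) :
    mfderiv I 𝓘(ℝ, F) (extChartAt I x) ((extChartAt I x).symm y)
      (mfderiv 𝓘(ℝ, F) I (extChartAt I x).symm y v) = v := by
  have h := mfderiv_extChartAt_comp_mfderivWithin_extChartAt_symm hy
  rw [I.range_eq_univ, mfderivWithin_univ] at h
  exact DFunLike.congr_fun h v

theorem oneFormInChart_liouvilleForm {α : CotangentBundle E M} {y : E × (E →L[ℝ] ℝ)}
    (hy : y ∈ (extChartAt (cotModel E) α).target) (v : E × (E →L[ℝ] ℝ)) :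
    oneFormInChart (I := cotModel E) (liouvilleForm (E := E) (M := M)) α y v = y.2 v.1 := by
  have hs := (extChartAt (cotModel E) α).map_target hy
  rw [cotangentChart_source] at hs
  refine (liouvilleForm_apply hs _).trans ?_
  rw [(extChartAt (cotModel E) α).right_inv hy]
  exact congrArg (fun e : E × (E →L[ℝ] ℝ) => y.2 e.1)
    (mfderiv_extChartAt_mfderiv_symm_apply (I := cotModel E) hy v)

end

/-! ### The constant symplectic form on `E × E*`. -/

section
variable {E : Type*} [NormedAddCommGroup E] [NormedSpace ℝ E]

/-- The constant-coefficient symplectic form `dq ∧ dp` on `E × E*`. -/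
def modelSymplecticForm (u v : E × (E →L[ℝ] ℝ)) : ℝ := v.2 u.1 - u.2 v.1

/-- A local diffeomorphism of `E × E*` that preserves `p dq` preserves `dq ∧ dp`. -/
theorem modelSymplecticForm_fderiv {τ : E × (E →L[ℝ] ℝ) → E × (E →L[ℝ] ℝ)}
    {y : E × (E →L[ℝ] ℝ)} (hτ : ContDiffAt ℝ ∞ τ y)
    (h : ∀ᶠ z in 𝓝 y, ∀ v : E × (E →L[ℝ] ℝ), (τ z).2 (fderiv ℝ τ z v).1 = z.2 v.1)
    (u v : E × (E →L[ℝ] ℝ)) :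
    modelSymplecticForm (fderiv ℝ τ y u) (fderiv ℝ τ y v) = modelSymplecticForm u v := by
  have hd : DifferentiableAt ℝ τ y := hτ.differentiableAt (by simp)
  have hdd : DifferentiableAt ℝ (fderiv ℝ τ) y :=
    (hτ.fderiv_right (m := 1) (by norm_cast)).differentiableAt one_ne_zero
  -- Differentiate the invariance of `p dq` in the direction `u`. After antisymmetrizing in `u` and
  -- `v`, the second-derivative term drops out by symmetry.
  have key : ∀ u v : E × (E →L[ℝ] ℝ),
      (fderiv ℝ τ y u).2 (fderiv ℝ τ y v).1 + (τ y).2 (fderiv ℝ (fderiv ℝ τ) y u v).1 =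
        u.2 v.1 := by
    intro u v
    have h1 : HasFDerivAt (fun z => (τ z).2 (fderiv ℝ τ z v).1) _ y :=
      hd.hasFDerivAt.snd.clm_apply (hdd.hasFDerivAt.clm_apply (hasFDerivAt_const v y)).fst
    have h2 : HasFDerivAt (fun z : E × (E →L[ℝ] ℝ) => z.2 v.1) _ y :=
      (hasFDerivAt_id y).snd.clm_apply (hasFDerivAt_const v.1 y)
    have h3 := (h1.congr_of_eventuallyEq
      (EventuallyEq.symm (h.mono fun z hz => hz v))).unique h2
    have h4 := DFunLike.congr_fun h3 u
    simp at h4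
    linarith
  have hsymm : IsSymmSndFDerivAt ℝ τ y := hτ.isSymmSndFDerivAt (by simp; exact WithTop.coe_le_coe.2 le_top)
  have h1 := key u v
  have h2 := key v u
  rw [hsymm v u] at h2
  unfold modelSymplecticForm
  linarith

end

/-! ### The canonical symplectic form in natural charts. -/

section
variable {E : Type*} [NormedAddCommGroup E] [NormedSpace ℝ E]
  {M : Type*} [TopologicalSpace M] [ChartedSpace E M] [IsManifold 𝓘(ℝ, E) ∞ M]

theorem fderiv_oneFormInChart_liouvilleForm {α : CotangentBundle E M} {y : E × (E →L[ℝ] ℝ)}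
    (hy : y ∈ (extChartAt (cotModel E) α).target) (u v : E × (E →L[ℝ] ℝ)) :
    fderiv ℝ (oneFormInChart (I := cotModel E) (liouvilleForm (E := E) (M := M)) α) y u v =
      u.2 v.1 := by
  let Λ : E × (E →L[ℝ] ℝ) →L[ℝ] E × (E →L[ℝ] ℝ) →L[ℝ] ℝ :=
    ((ContinuousLinearMap.compL ℝ (E × (E →L[ℝ] ℝ)) E ℝ).flip
      (ContinuousLinearMap.fst ℝ E (E →L[ℝ] ℝ))).comp (ContinuousLinearMap.snd ℝ E (E →L[ℝ] ℝ))
  -- `p dq` has coefficients linear in `(q, p)`, so it is its own derivative.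
  have h : oneFormInChart (I := cotModel E) (liouvilleForm (E := E) (M := M)) α =ᶠ[𝓝 y] Λ := by
    filter_upwards [(isOpen_extChartAt_target α).mem_nhds hy] with z hz
    refine ContinuousLinearMap.ext fun v => ?_
    exact oneFormInChart_liouvilleForm hz v
  have hΛ : fderiv ℝ Λ y = Λ :=
    ContinuousLinearMap.fderiv (𝕜 := ℝ) (E := E × (E →L[ℝ] ℝ)) (F := E × (E →L[ℝ] ℝ) →L[ℝ] ℝ) Λ
  rw [h.fderiv_eq]
  exact DFunLike.congr_fun (DFunLike.congr_fun hΛ u) v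

/-- This covers only the center of the chart, where `extDerivOneForm` is computed in that same
chart. -/
theorem canonicalSymplecticForm_eq_self (α : CotangentBundle E M)
    (u v : TangentSpace (cotModel E) α) :
    canonicalSymplecticForm α u v =
      modelSymplecticForm (cotangentChartDeriv α α u) (cotangentChartDeriv α α v) := by
  have h := fderiv_oneFormInChart_liouvilleForm (mem_extChartAt_target (I := cotModel E) α)
  change -(fderiv ℝ (oneFormInChart (I := cotModel E) (liouvilleForm (E := E) (M := M)) α)
      (extChartAt (cotModel E) α α) (cotangentChartDeriv α α u) (cotangentChartDeriv α α v) -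
    fderiv ℝ (oneFormInChart (I := cotModel E) (liouvilleForm (E := E) (M := M)) α)
      (extChartAt (cotModel E) α α) (cotangentChartDeriv α α v) (cotangentChartDeriv α α u)) = _
  rw [h, h]
  unfold modelSymplecticForm
  ring

/-- The canonical symplectic form is `dq ∧ dp` in every natural chart. -/
theorem canonicalSymplecticForm_eq {α β : CotangentBundle E M}
    (h : β.1 ∈ (chartAt E α.1).source) (u v : TangentSpace (cotModel E) β) :
    canonicalSymplecticForm β u v =
      modelSymplecticForm (cotangentChartDeriv α β u) (cotangentChartDeriv α β v) := by
  have hs : β ∈ (extChartAt (cotModel E) α).source := by rwa [cotangentChart_source]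
  set τ : E × (E →L[ℝ] ℝ) → E × (E →L[ℝ] ℝ) :=
    extChartAt (cotModel E) α ∘ (extChartAt (cotModel E) β).symm with hτdef
  have hy : extChartAt (cotModel E) β β ∈ (extChartAt (cotModel E) β).target :=
    mem_extChartAt_target β
  have hev : ∀ᶠ z in 𝓝 (extChartAt (cotModel E) β β), z ∈ (extChartAt (cotModel E) β).target ∧
      (extChartAt (cotModel E) β).symm z ∈ (extChartAt (cotModel E) α).source := by
    refine ((isOpen_extChartAt_target β).mem_nhds hy |> Filter.Eventually.and) ?_
    refine (continuousAt_extChartAt_symm β).preimage_mem_nhds ?_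
    rw [extChartAt_to_inv]
    exact (isOpen_extChartAt_source α).mem_nhds hs
  have hsm : ∀ z, z ∈ (extChartAt (cotModel E) β).target →
      (extChartAt (cotModel E) β).symm z ∈ (extChartAt (cotModel E) α).source →
      ContDiffAt ℝ ∞ τ z := by
    intro z hz hz'
    rw [← contMDiffAt_iff_contDiffAt]
    refine ContMDiffAt.comp z (I' := cotModel E) (contMDiffAt_extChartAt' ?_)
      ((contMDiffOn_extChartAt_symm β).contMDiffAt ((isOpen_extChartAt_target β).mem_nhds hz))
    rwa [extChartAt_source] at hz'
  have hchain : ∀ z, z ∈ (extChartAt (cotModel E) β).target →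
      (extChartAt (cotModel E) β).symm z ∈ (extChartAt (cotModel E) α).source →
      ∀ v, fderiv ℝ τ z v = mfderiv (cotModel E) 𝓘(ℝ, E × (E →L[ℝ] ℝ))
        (extChartAt (cotModel E) α) ((extChartAt (cotModel E) β).symm z)
        (mfderiv 𝓘(ℝ, E × (E →L[ℝ] ℝ)) (cotModel E) (extChartAt (cotModel E) β).symm z v) := by
    intro z hz hz' v
    rw [extChartAt_source] at hz'
    have hc : MDifferentiableAt (cotModel E) 𝓘(ℝ, E × (E →L[ℝ] ℝ)) (extChartAt (cotModel E) α)
      ((extChartAt (cotModel E) β).symm z) := mdifferentiableAt_extChartAt hz'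
    have := mfderiv_comp z hc (mdifferentiableAt_extChartAt_symm_of_boundaryless hz)
    rw [mfderiv_eq_fderiv] at this
    exact DFunLike.congr_fun this v
  -- Both charts represent the same intrinsic form `θ` as `p dq`, so the transition map preserves `p
  -- dq`.
  have hpres : ∀ᶠ z in 𝓝 (extChartAt (cotModel E) β β), ∀ v : E × (E →L[ℝ] ℝ),
      (τ z).2 (fderiv ℝ τ z v).1 = z.2 v.1 := by
    filter_upwards [hev] with z hz v
    rw [hchain z hz.1 hz.2, ← oneFormInChart_liouvilleForm hz.1 v]
    have hz' := hz.2
    rw [cotangentChart_source] at hz'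
    exact (liouvilleForm_apply hz' _).symm
  have hA : ∀ w, cotangentChartDeriv α β w =
      fderiv ℝ τ (extChartAt (cotModel E) β β) (cotangentChartDeriv β β w) := by
    intro w
    have hc : MDifferentiableAt (cotModel E) 𝓘(ℝ, E × (E →L[ℝ] ℝ)) (extChartAt (cotModel E) β) β :=
      mdifferentiableAt_extChartAt (mem_chart_source _ β)
    have ht : MDifferentiableAt 𝓘(ℝ, E × (E →L[ℝ] ℝ)) 𝓘(ℝ, E × (E →L[ℝ] ℝ)) τ
        (extChartAt (cotModel E) β β) :=
      ((hsm _ hy hev.self_of_nhds.2).differentiableAt (by simp)).mdifferentiableAt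
    have h1 := mfderiv_comp β ht hc
    have h2 : τ ∘ extChartAt (cotModel E) β =ᶠ[𝓝 β] extChartAt (cotModel E) α := by
      filter_upwards [(isOpen_extChartAt_source β).mem_nhds
        (mem_extChartAt_source (I := cotModel E) β)] with γ hγ
      simp only [hτdef, Function.comp_apply, (extChartAt (cotModel E) β).left_inv hγ]
    rw [h2.mfderiv_eq, mfderiv_eq_fderiv] at h1
    exact DFunLike.congr_fun h1 w
  rw [hA u, hA v, modelSymplecticForm_fderiv (hsm _ hy hev.self_of_nhds.2) hpres]
  exact canonicalSymplecticForm_eq_self β u v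

end

/-! ### Hamiltonian vectors on `E × E*`. -/

section
variable {E : Type*} [NormedAddCommGroup E] [NormedSpace ℝ E]

/-- Testing against `(0, γ)` detects the `E`-component, as functionals separate points; testing
against `(e, 0)` detects the `E*`-component. -/
theorem modelSymplecticForm_nondegenerate {u u' : E × (E →L[ℝ] ℝ)}
    (h : ∀ w, modelSymplecticForm u w = modelSymplecticForm u' w) : u = u' := by
  refine Prod.ext ?_ (ContinuousLinearMap.ext fun e => ?_)
  · refine (SeparatingDual.eq_iff_forall_dual_eq (R := ℝ)).2 fun γ => ?_
    have := h (0, γ)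
    simpa [modelSymplecticForm] using this
  · have := h (e, 0)
    simpa [modelSymplecticForm] using this

variable [FiniteDimensional ℝ E]

/-- The vector `(∂H/∂p, -∂H/∂q)` of a differential `dH` on `E × E*`. -/
def modelHamiltonianVector (l : E × (E →L[ℝ] ℝ) →L[ℝ] ℝ) : E × (E →L[ℝ] ℝ) :=
  (ofBidual (l.comp (ContinuousLinearMap.inr ℝ E (E →L[ℝ] ℝ))),
    -l.comp (ContinuousLinearMap.inl ℝ E (E →L[ℝ] ℝ)))

theorem modelSymplecticForm_hamiltonianVector (l : E × (E →L[ℝ] ℝ) →L[ℝ] ℝ)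
    (w : E × (E →L[ℝ] ℝ)) : modelSymplecticForm (modelHamiltonianVector l) w = l w := by
  have h : l w = l (0, w.2) + l (w.1, 0) := by
    rw [← map_add]
    simp
  simp only [modelSymplecticForm, modelHamiltonianVector, apply_ofBidual]
  rw [h]
  simp

/-- Nondegeneracy forces linearity in `l`, and a linear map out of a finite-dimensional space is
continuous, hence smooth. -/
theorem contDiff_modelHamiltonianVector {n : WithTop ℕ∞} :
    ContDiff ℝ n (modelHamiltonianVector (E := E)) := by
  let J : (E × (E →L[ℝ] ℝ) →L[ℝ] ℝ) →ₗ[ℝ] E × (E →L[ℝ] ℝ) :=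
    { toFun := modelHamiltonianVector
      map_add' := fun l l' => modelSymplecticForm_nondegenerate fun w => by
        rw [modelSymplecticForm_hamiltonianVector]
        have h := modelSymplecticForm_hamiltonianVector l w
        have h' := modelSymplecticForm_hamiltonianVector l' w
        simp only [modelSymplecticForm, Prod.fst_add, Prod.snd_add, map_add,
          add_apply] at h h' ⊢
        linarith
      map_smul' := fun c l => modelSymplecticForm_nondegenerate fun w => by
        rw [modelSymplecticForm_hamiltonianVector]
        have h := modelSymplecticForm_hamiltonianVector l w
        simp only [modelSymplecticForm, RingHom.id_apply, Prod.smul_fst, Prod.smul_snd, map_smul,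
          smul_apply, smul_eq_mul] at h ⊢
        rw [← h]
        ring }
  exact ContinuousLinearMap.contDiff (𝕜 := ℝ) (E := E × (E →L[ℝ] ℝ) →L[ℝ] ℝ)
    (F := E × (E →L[ℝ] ℝ)) (LinearMap.toContinuousLinearMap (𝕜 := ℝ)
      (E := E × (E →L[ℝ] ℝ) →L[ℝ] ℝ) (F' := E × (E →L[ℝ] ℝ)) J)

end

/-! ### Existence, uniqueness and smoothness of the Hamiltonian vector field. -/

section
variable {E : Type*} [NormedAddCommGroup E] [NormedSpace ℝ E]
  {M : Type*} [TopologicalSpace M] [ChartedSpace E M] [IsManifold 𝓘(ℝ, E) ∞ M]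

/-- `TangentSpace` at `α` is the model space, identified through the preferred chart at `α`. This is
why `hamiltonianVectorField` can use a model vector directly as a tangent vector. -/
theorem cotangentChartDeriv_self (α : CotangentBundle E M) (w : TangentSpace (cotModel E) α) :
    cotangentChartDeriv α α w = w :=
  DFunLike.congr_fun (mfderiv_extChartAt_self (I := cotModel E) (x := α)) w

theorem cotangentChartDeriv_isInvertible {α β : CotangentBundle E M}
    (h : β.1 ∈ (chartAt E α.1).source) : (cotangentChartDeriv α β).IsInvertible :=
  isInvertible_mfderiv_extChartAt (I := cotModel E) (by rwa [cotangentChart_source])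

/-- A function on `T*M` in the natural chart at `α`. -/
def cotangentLocalRep (H : CotangentBundle E M → ℝ) (α : CotangentBundle E M) :
    E × (E →L[ℝ] ℝ) → ℝ := H ∘ (extChartAt (cotModel E) α).symm

theorem contDiffOn_cotangentLocalRep {H : CotangentBundle E M → ℝ}
    (hH : ContMDiff (cotModel E) 𝓘(ℝ, ℝ) ∞ H) (α : CotangentBundle E M) :
    ContDiffOn ℝ ∞ (cotangentLocalRep H α) (extChartAt (cotModel E) α).target := by
  rw [← contMDiffOn_iff_contDiffOn]
  exact hH.comp_contMDiffOn (contMDiffOn_extChartAt_symm α)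

theorem mfderiv_eq_fderiv_cotangentLocalRep {H : CotangentBundle E M → ℝ}
    (hH : ContMDiff (cotModel E) 𝓘(ℝ, ℝ) ∞ H) {α β : CotangentBundle E M}
    (h : β.1 ∈ (chartAt E α.1).source) (w : TangentSpace (cotModel E) β) :
    mfderiv (cotModel E) 𝓘(ℝ, ℝ) H β w =
      fderiv ℝ (cotangentLocalRep H α) (extChartAt (cotModel E) α β)
        (cotangentChartDeriv α β w) := by
  have hs : β ∈ (extChartAt (cotModel E) α).source := by rwa [cotangentChart_source]
  have hc : MDifferentiableAt (cotModel E) 𝓘(ℝ, E × (E →L[ℝ] ℝ)) (extChartAt (cotModel E) α) β :=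
    mdifferentiableAt_extChartAt (by rwa [extChartAt_source] at hs)
  have hd : MDifferentiableAt 𝓘(ℝ, E × (E →L[ℝ] ℝ)) 𝓘(ℝ, ℝ) (cotangentLocalRep H α)
      (extChartAt (cotModel E) α β) :=
    (((contDiffOn_cotangentLocalRep hH α).contDiffAt ((isOpen_extChartAt_target α).mem_nhds
      ((extChartAt (cotModel E) α).map_source hs))).differentiableAt (by simp)).mdifferentiableAt
  have h1 := mfderiv_comp β hd hc
  have h2 : cotangentLocalRep H α ∘ extChartAt (cotModel E) α =ᶠ[𝓝 β] H := by
    filter_upwards [(isOpen_extChartAt_source α).mem_nhds hs] with γ hγ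
    simp only [cotangentLocalRep, Function.comp_apply, (extChartAt (cotModel E) α).left_inv hγ]
  rw [h2.mfderiv_eq, mfderiv_eq_fderiv] at h1
  exact DFunLike.congr_fun h1 w

variable [FiniteDimensional ℝ E]

/-- Hamilton's equations in an arbitrary natural chart around `β`. Existence and uniqueness use `α =
β`; smoothness uses a fixed `α` with `β` varying. -/
theorem isHamiltonian_at_iff {H : CotangentBundle E M → ℝ}
    (hH : ContMDiff (cotModel E) 𝓘(ℝ, ℝ) ∞ H) {α β : CotangentBundle E M}
    (h : β.1 ∈ (chartAt E α.1).source) (X : TangentSpace (cotModel E) β) :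
    (∀ w, canonicalSymplecticForm β X w = mfderiv (cotModel E) 𝓘(ℝ, ℝ) H β w) ↔
      cotangentChartDeriv α β X = modelHamiltonianVector
        (fderiv ℝ (cotangentLocalRep H α) (extChartAt (cotModel E) α β)) := by
  constructor
  · intro hX
    refine modelSymplecticForm_nondegenerate fun w => ?_
    obtain ⟨w, rfl⟩ := (cotangentChartDeriv_isInvertible h).bijective.surjective w
    rw [← canonicalSymplecticForm_eq h, hX, modelSymplecticForm_hamiltonianVector]
    exact mfderiv_eq_fderiv_cotangentLocalRep hH h w
  · intro hX w
    rw [canonicalSymplecticForm_eq h, hX, modelSymplecticForm_hamiltonianVector]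
    exact (mfderiv_eq_fderiv_cotangentLocalRep hH h w).symm

/-- The Hamiltonian vector field of `H`. -/
def hamiltonianVectorField (H : CotangentBundle E M → ℝ) (α : CotangentBundle E M) :
    TangentSpace (cotModel E) α :=
  modelHamiltonianVector (fderiv ℝ (cotangentLocalRep H α) (extChartAt (cotModel E) α α))

theorem hamiltonianVectorField_spec {H : CotangentBundle E M → ℝ}
    (hH : ContMDiff (cotModel E) 𝓘(ℝ, ℝ) ∞ H) (α : CotangentBundle E M)
    (w : TangentSpace (cotModel E) α) :
    canonicalSymplecticForm α (hamiltonianVectorField H α) w =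
      mfderiv (cotModel E) 𝓘(ℝ, ℝ) H α w :=
  (isHamiltonian_at_iff hH (mem_chart_source E α.1) _).2 (cotangentChartDeriv_self _ _) w

theorem contMDiff_hamiltonianVectorField {H : CotangentBundle E M → ℝ}
    (hH : ContMDiff (cotModel E) 𝓘(ℝ, ℝ) ∞ H) :
    ContMDiff (cotModel E) (cotModel E).tangent ∞ (fun α =>
      (⟨α, hamiltonianVectorField H α⟩ : TangentBundle (cotModel E) (CotangentBundle E M))) := by
  intro α
  refine (Bundle.contMDiffAt_section α).2 ?_
  have hs : α ∈ (extChartAt (cotModel E) α).source := mem_extChartAt_source α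
  have h1 : ContDiffOn ℝ ∞ (fun y => modelHamiltonianVector
      (fderiv ℝ (cotangentLocalRep H α) y)) (extChartAt (cotModel E) α).target :=
    contDiff_modelHamiltonianVector.comp_contDiffOn
      ((contDiffOn_cotangentLocalRep hH α).fderiv_of_isOpen (isOpen_extChartAt_target α) (by simp))
  have h2 : ContMDiffAt (cotModel E) 𝓘(ℝ, E × (E →L[ℝ] ℝ)) ∞ ((fun y => modelHamiltonianVector
      (fderiv ℝ (cotangentLocalRep H α) y)) ∘ extChartAt (cotModel E) α) α :=
    ContMDiffAt.comp α (h1.contDiffAt ((isOpen_extChartAt_target α).mem_nhds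
      (mem_extChartAt_target α))).contMDiffAt contMDiffAt_extChartAt
  refine h2.congr_of_eventuallyEq ?_
  filter_upwards [(isOpen_extChartAt_source α).mem_nhds hs] with β hβ
  have hβ' := hβ
  rw [cotangentChart_source] at hβ'
  rw [extChartAt_source] at hβ
  -- The field is defined chart by chart at each point; its intrinsic characterization gives its
  -- components at `β` in the fixed chart at `α`.
  have h3 := (isHamiltonian_at_iff hH hβ' _).1 (hamiltonianVectorField_spec hH β)
  refine Eq.trans ?_ h3
  unfold cotangentChartDeriv
  rw [← TangentBundle.continuousLinearMapAt_trivializationAt hβ]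
  exact (congrFun (Bundle.Trivialization.coe_linearMapAt_of_mem (R := ℝ)
    (e := trivializationAt (E × (E →L[ℝ] ℝ)) (TangentSpace (cotModel E)) α) hβ) _).symm

theorem isHamiltonianVectorField_hamiltonianVectorField {H : CotangentBundle E M → ℝ}
    (hH : ContMDiff (cotModel E) 𝓘(ℝ, ℝ) ∞ H) :
    IsHamiltonianVectorField H (hamiltonianVectorField H) :=
  ⟨contMDiff_hamiltonianVectorField hH, hamiltonianVectorField_spec hH⟩

theorem IsHamiltonianVectorField.eq_hamiltonianVectorField {H : CotangentBundle E M → ℝ}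
    (hH : ContMDiff (cotModel E) 𝓘(ℝ, ℝ) ∞ H)
    {Y : ∀ α : CotangentBundle E M, TangentSpace (cotModel E) α}
    (hY : IsHamiltonianVectorField H Y) : Y = hamiltonianVectorField H := by
  funext α
  have h := (isHamiltonian_at_iff hH (mem_chart_source E α.1) _).1 (hY.2 α)
  rw [cotangentChartDeriv_self] at h
  exact h

end

/-! ### The derivative of a Legendre transform. -/

section
variable {E : Type*} [NormedAddCommGroup E] [NormedSpace ℝ E]

/-- The derivative of a Legendre transform `w ↦ b w w - h (b w)`, where `dh (b w) = w`. -/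
theorem fderiv_legendre {b : E → E →L[ℝ] ℝ} {h : (E →L[ℝ] ℝ) → ℝ} {w : E}
    {D : (E →L[ℝ] ℝ) →L[ℝ] ℝ} (hb : DifferentiableAt ℝ b w) (hh : HasFDerivAt h D (b w))
    (hD : ∀ γ, D γ = γ w) : fderiv ℝ (fun u => b u u - h (b u)) w = b w := by
  -- The derivative along `e` is `b w e + (Db e) w - D (Db e)`, and `hD` cancels the last two terms.
  have h1 : HasFDerivAt (fun u => b u u - h (b u)) _ w :=
    (hb.hasFDerivAt.clm_apply (hasFDerivAt_id w)).sub (hh.comp w hb.hasFDerivAt)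
  rw [h1.fderiv]
  ext e
  simp [hD]

end

/-! ### Restriction of functions to a fiber of `T*M`. -/

section
variable {E : Type*} [NormedAddCommGroup E] [NormedSpace ℝ E]
  {M : Type*} [TopologicalSpace M] [ChartedSpace E M] [IsManifold 𝓘(ℝ, E) ∞ M]

/-- The base chart has identity derivative at its own center, so no change of basis occurs on the
fiber through `α`. -/
theorem cotangentChart_fiber (α : CotangentBundle E M) (β : CotangentSpace E α.1) :
    extChartAt (cotModel E) α ⟨α.1, β⟩ = (extChartAt 𝓘(ℝ, E) α.1 α.1, β) := by
  refine Prod.ext (cotangentChart_apply_fst α ⟨α.1, β⟩) (ContinuousLinearMap.ext fun w => ?_)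
  have h := snd_apply_eq_cotangentChart (α := α) (β := ⟨α.1, β⟩) (mem_chart_source E α.1) w
  rw [mfderiv_extChartAt_self] at h
  exact h.symm

theorem hasFDerivAt_fiber {H : CotangentBundle E M → ℝ}
    (hH : ContMDiff (cotModel E) 𝓘(ℝ, ℝ) ∞ H) (α : CotangentBundle E M) :
    HasFDerivAt (E := E →L[ℝ] ℝ) (fun β => H ⟨α.1, β⟩)
      ((fderiv ℝ (cotangentLocalRep H α) (extChartAt (cotModel E) α α)).comp
        (ContinuousLinearMap.inr ℝ E (E →L[ℝ] ℝ))) α.2 := by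
  have hα : extChartAt (cotModel E) α α = (extChartAt 𝓘(ℝ, E) α.1 α.1, α.2) :=
    cotangentChart_fiber α α.2
  have hd : HasFDerivAt (cotangentLocalRep H α)
      (fderiv ℝ (cotangentLocalRep H α) (extChartAt (cotModel E) α α))
      (extChartAt (cotModel E) α α) :=
    (((contDiffOn_cotangentLocalRep hH α).contDiffAt ((isOpen_extChartAt_target α).mem_nhds
      (mem_extChartAt_target α))).differentiableAt (by simp)).hasFDerivAt
  rw [hα] at hd
  rw [hα]
  have h1 := hd.comp (𝕜 := ℝ) (E := E →L[ℝ] ℝ) α.2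
    (hasFDerivAt_prodMk_right (𝕜 := ℝ) (E := E) (F := E →L[ℝ] ℝ)
      (extChartAt 𝓘(ℝ, E) α.1 α.1) α.2)
  refine h1.congr_of_eventuallyEq (Eventually.of_forall fun β => ?_)
  have hs : (⟨α.1, β⟩ : CotangentBundle E M) ∈ (extChartAt (cotModel E) α).source := by
    rw [cotangentChart_source]
    exact mem_chart_source E α.1
  exact congrArg H (((extChartAt (cotModel E) α).left_inv hs).symm.trans
    (congrArg (extChartAt (cotModel E) α).symm (cotangentChart_fiber α β)))

end

/-! ### The Lagrangian, its smoothness and its fiber derivative. -/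

section
variable {E : Type*} [NormedAddCommGroup E] [NormedSpace ℝ E] [FiniteDimensional ℝ E]
  {M : Type*} [TopologicalSpace M] [ChartedSpace E M] [IsManifold 𝓘(ℝ, E) ∞ M]

/-- In the chart at `α` both sides are `p · ∂H/∂p`: the `q`-part of the Hamiltonian vector is the
fiber derivative of `H`. -/
theorem liouvilleForm_hamiltonianVectorField {H : CotangentBundle E M → ℝ}
    (hH : ContMDiff (cotModel E) 𝓘(ℝ, ℝ) ∞ H) (α : CotangentBundle E M) :
    liouvilleForm α (hamiltonianVectorField H α) = α.2 (fiberDerivHamiltonian H α).2 := by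
  have h1 : α.2 (fiberDerivHamiltonian H α).2 =
      fderiv ℝ (fun β : CotangentSpace E α.1 => H ⟨α.1, β⟩) α.2 α.2 := apply_ofBidual _ _
  rw [h1, liouvilleForm_apply (mem_chart_source E α.1), cotangentChartDeriv_self]
  refine (apply_ofBidual _ _).trans ?_
  have h2 := (hasFDerivAt_fiber hH α).fderiv
  refine Eq.trans ?_ (DFunLike.congr_fun h2 α.2).symm
  have h3 : (extChartAt (cotModel E) α α).2 = α.2 := congrArg Prod.snd (cotangentChart_fiber α α.2)
  rw [h3]
  rfl

theorem IsHyperregularHamiltonian.lagrangian_eq {H : CotangentBundle E M → ℝ}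
    (hH : IsHyperregularHamiltonian H) (v : TangentBundle 𝓘(ℝ, E) M) :
    hH.lagrangian (hamiltonianVectorField H) v =
      (hH.fiberDerivInv v).2 (fiberDerivHamiltonian H (hH.fiberDerivInv v)).2 -
        H (hH.fiberDerivInv v) := by
  unfold IsHyperregularHamiltonian.lagrangian
  rw [liouvilleForm_hamiltonianVectorField hH.1]

theorem IsHyperregularHamiltonian.contMDiff_fiberDeriv {H : CotangentBundle E M → ℝ}
    (hH : IsHyperregularHamiltonian H) :
    ContMDiff (cotModel E) (tanModel E) ∞ (fiberDerivHamiltonian H) := by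
  rw [← hH.2.choose_spec]
  exact hH.2.choose.contMDiff

theorem IsHyperregularHamiltonian.contMDiff_fiberDerivInv {H : CotangentBundle E M → ℝ}
    (hH : IsHyperregularHamiltonian H) :
    ContMDiff (tanModel E) (cotModel E) ∞ hH.fiberDerivInv :=
  hH.2.choose.symm.contMDiff

theorem IsHyperregularHamiltonian.contMDiff_lagrangian {H : CotangentBundle E M → ℝ}
    (hH : IsHyperregularHamiltonian H) :
    ContMDiff (tanModel E) 𝓘(ℝ, ℝ) ∞ (hH.lagrangian (hamiltonianVectorField H)) := by
  -- The pairing `α(𝓕H α)` is evaluation of a smooth family of bundle homomorphisms, into the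
  -- trivial line bundle, on a smooth family of vectors over the same base point.
  have h1 : ContMDiff (cotModel E) (𝓘(ℝ, E).prod 𝓘(ℝ, ℝ)) ∞ (fun α : CotangentBundle E M =>
      Bundle.TotalSpace.mk' ℝ (E := fun _ : M => ℝ) α.1 (α.2 (fiberDerivHamiltonian H α).2)) :=
    ContMDiff.clm_bundle_apply (F₁ := E) (E₁ := fun x : M => TangentSpace 𝓘(ℝ, E) x)
      (F₂ := ℝ) (E₂ := fun _ : M => ℝ) (b := fun α : CotangentBundle E M => α.1)
      (ϕ := fun α => α.2) (v := fun α => (fiberDerivHamiltonian H α).2)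
      contMDiff_id hH.contMDiff_fiberDeriv
  have h2 : ContMDiff (cotModel E) 𝓘(ℝ, ℝ) ∞ (fun α : CotangentBundle E M =>
      α.2 (fiberDerivHamiltonian H α).2) := fun α =>
    (Bundle.contMDiffAt_totalSpace.1 (h1 α)).2
  have h3 : hH.lagrangian (hamiltonianVectorField H) = (fun α : CotangentBundle E M =>
      α.2 (fiberDerivHamiltonian H α).2 - H α) ∘ hH.fiberDerivInv :=
    funext hH.lagrangian_eq
  rw [h3]
  exact (h2.sub hH.1).comp hH.contMDiff_fiberDerivInv

theorem contMDiff_tangentFiber (x : M) : ContMDiff 𝓘(ℝ, E) (tanModel E) ∞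
    (fun w : E => (⟨x, w⟩ : TangentBundle 𝓘(ℝ, E) M)) := by
  intro w
  refine Bundle.contMDiffAt_totalSpace.2 ⟨contMDiffAt_const, ?_⟩
  refine (contMDiffAt_id (I := 𝓘(ℝ, E)) (x := w)).congr_of_eventuallyEq
    (Eventually.of_forall fun u => ?_)
  have h := TangentBundle.continuousLinearMapAt_trivializationAt (I := 𝓘(ℝ, E))
    (mem_chart_source E x)
  rw [mfderiv_extChartAt_self] at h
  refine Eq.trans ?_ (DFunLike.congr_fun h u)
  exact (congrFun (Bundle.Trivialization.coe_linearMapAt_of_mem (R := ℝ)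
    (e := trivializationAt E (TangentSpace 𝓘(ℝ, E)) x) (mem_chart_source E x)) _).symm

theorem differentiable_of_contMDiff_cotangentFiber {x : M} {b : E → E →L[ℝ] ℝ}
    (h : ContMDiff 𝓘(ℝ, E) (cotModel E) ∞ (fun w => (⟨x, b w⟩ : CotangentBundle E M))) :
    Differentiable ℝ b := by
  intro w
  have h1 := (contMDiffAt_extChartAt (I := cotModel E) (n := ∞)
    (x := (⟨x, b w⟩ : CotangentBundle E M))).comp w (h w)
  have h2 : extChartAt (cotModel E) (⟨x, b w⟩ : CotangentBundle E M) ∘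
      (fun w => (⟨x, b w⟩ : CotangentBundle E M)) = fun u => (extChartAt 𝓘(ℝ, E) x x, b u) :=
    funext fun u => cotangentChart_fiber ⟨x, b w⟩ (b u)
  rw [h2, contMDiffAt_iff_contDiffAt] at h1
  exact (h1.differentiableAt (by simp)).snd

/-- The fiber derivative and the Lagrangian over a fixed point: `𝓕H⁻¹ (x, u) = (x, β)` with
`∂H/∂p (x, β) = u` and `L (x, u) = β u - H (x, β)`. -/
theorem IsHyperregularHamiltonian.exists_fiberDerivInv_eq {H : CotangentBundle E M → ℝ}
    (hH : IsHyperregularHamiltonian H) (x : M) (u : TangentSpace 𝓘(ℝ, E) x) :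
    ∃ β : CotangentSpace E x, hH.fiberDerivInv ⟨x, u⟩ = ⟨x, β⟩ ∧
      ofBidual (fderiv ℝ (fun β : CotangentSpace E x => H ⟨x, β⟩) β) = u ∧
      hH.lagrangian (hamiltonianVectorField H) ⟨x, u⟩ = β u - H ⟨x, β⟩ := by
  have h : (hH.fiberDerivInv ⟨x, u⟩).1 = x :=
    congrArg Bundle.TotalSpace.proj (hH.fiberDeriv_inv ⟨x, u⟩)
  have h1 := hH.fiberDeriv_inv ⟨x, u⟩
  have h2 := hH.lagrangian_eq ⟨x, u⟩
  -- The base point of `𝓕H⁻¹(x, u)` equals `x` only propositionally; abstracting the covector lets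
  -- the two be identified.
  generalize hH.fiberDerivInv ⟨x, u⟩ = α at h h1 h2
  obtain ⟨y, β⟩ := α
  obtain rfl : y = x := h
  have h3 := eq_of_heq (Bundle.TotalSpace.mk.inj h1).2
  exact ⟨β, rfl, h3, h2.trans (congrArg (fun e => β e - H ⟨y, β⟩) h3)⟩

theorem IsHyperregularHamiltonian.fiberDerivLagrangian_lagrangian {H : CotangentBundle E M → ℝ}
    (hH : IsHyperregularHamiltonian H) :
    fiberDerivLagrangian (hH.lagrangian (hamiltonianVectorField H)) = hH.fiberDerivInv := by
  funext ⟨x, w⟩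
  choose b' hb' hw' hL' using hH.exists_fiberDerivInv_eq x
  -- The fiber map is retyped between the model normed spaces, where `fderiv_legendre` applies.
  obtain ⟨b, hb, hw, hL⟩ : ∃ b : E → E →L[ℝ] ℝ,
      (∀ u : E, hH.fiberDerivInv (⟨x, u⟩ : TangentBundle 𝓘(ℝ, E) M) = ⟨x, b u⟩) ∧
      (∀ u : E, ofBidual (fderiv ℝ (fun β : CotangentSpace E x => H ⟨x, β⟩) (b u)) = u) ∧
      ∀ u : E, hH.lagrangian (hamiltonianVectorField H) ⟨x, u⟩ = b u u - H ⟨x, b u⟩ :=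
    ⟨b', hb', hw', hL'⟩
  have hbd : Differentiable ℝ b := by
    refine differentiable_of_contMDiff_cotangentFiber (x := x) ?_
    have h := hH.contMDiff_fiberDerivInv.comp (contMDiff_tangentFiber x)
    exact h.congr fun u => (hb u).symm
  rw [hb w]
  have h1 := hasFDerivAt_fiber hH.1 (⟨x, b w⟩ : CotangentBundle E M)
  -- The hypothesis `D γ = γ w` is the equation `𝓕H(x, b w) = (x, w)` read through the bidual.
  have h2 := fderiv_legendre (hbd w) h1 (fun γ => by
    refine (DFunLike.congr_fun h1.fderiv γ).symm.trans ?_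
    refine (apply_ofBidual (V := TangentSpace 𝓘(ℝ, E) x) _ _).symm.trans ?_
    exact congrArg γ (hw w))
  have h3 : (fun u : E => hH.lagrangian (hamiltonianVectorField H) ⟨x, u⟩) =
      fun u => b u u - H ⟨x, b u⟩ := funext hL
  rw [← h3] at h2
  exact congrArg (fun β : E →L[ℝ] ℝ => (⟨x, β⟩ : CotangentBundle E M)) h2

theorem IsHyperregularHamiltonian.isHyperregularLagrangian {H : CotangentBundle E M → ℝ}
    (hH : IsHyperregularHamiltonian H) :
    IsHyperregularLagrangian (hH.lagrangian (hamiltonianVectorField H)) :=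
  ⟨hH.contMDiff_lagrangian, hH.2.choose.symm, hH.fiberDerivLagrangian_lagrangian.symm⟩

end

/-! ### Natural coordinate bases on the higher tangent bundle. -/

section
variable {n r : ℕ} {Q : Type*} [TopologicalSpace Q] [ChartedSpace (EuclideanSpace ℝ (Fin n)) Q]
  [IsManifold (𝓡 n) ∞ Q]

theorem coord_mdifferentiable_invertible (φ : OpenPartialHomeomorph Q (EuclideanSpace ℝ (Fin n)))
    (hφ : φ ∈ IsManifold.maximalAtlas (𝓡 n) ∞ Q) {x : HigherTangentBundle n r Q}
    (hx : HigherTangent.base x ∈ φ.source) :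
    MDifferentiableAt 𝓘(ℝ, JetModel n r) 𝓘(ℝ, JetModel n r)
        (HigherTangent.coord φ : HigherTangentBundle n r Q → JetModel n r) x ∧
      (mfderiv 𝓘(ℝ, JetModel n r) 𝓘(ℝ, JetModel n r)
        (HigherTangent.coord φ : HigherTangentBundle n r Q → JetModel n r) x).IsInvertible := by
  -- The atlas of `HigherTangent.core` contains the charts induced by the whole maximal atlas of
  -- `Q`, so any `φ` is allowed.
  have hmem : HigherTangent.chart r φ hφ ∈
      (HigherTangent.core (EuclideanSpace ℝ (Fin n)) r Q).atlas := ⟨φ, hφ, rfl⟩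
  have hatlas : (HigherTangent.core (EuclideanSpace ℝ (Fin n)) r Q).openPartialHomeomorph
      (HigherTangent.chart r φ hφ) hmem ∈ atlas (JetModel n r) (HigherTangentBundle n r Q) :=
    mem_iUnion₂.2 ⟨_, hmem, rfl⟩
  have hd := mdifferentiable_of_mem_atlas (I := 𝓘(ℝ, JetModel n r)) hatlas
  exact ⟨hd.mdifferentiableAt hx, ⟨hd.mfderiv hx, rfl⟩⟩

/-- The tangent map of the natural coordinates. -/
def coordDeriv (φ : OpenPartialHomeomorph Q (EuclideanSpace ℝ (Fin n)))
    (x : HigherTangentBundle n r Q) : TangentSpace 𝓘(ℝ, JetModel n r) x →L[ℝ] JetModel n r :=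
  mfderiv 𝓘(ℝ, JetModel n r) 𝓘(ℝ, JetModel n r)
    (HigherTangent.coord φ : HigherTangentBundle n r Q → JetModel n r) x

theorem jetModel_sum_single (y : JetModel n r) :
    ∑ j, ∑ i, y j i • (Pi.single j (EuclideanSpace.single i (1 : ℝ)) : JetModel n r) = y := by
  ext j i
  simp [Finset.sum_apply, Pi.single_apply, apply_ite]

variable {φ : OpenPartialHomeomorph Q (EuclideanSpace ℝ (Fin n))}
  {x : HigherTangentBundle n r Q}

/-- `vectorOfChart` uses `ContinuousLinearMap.inverse`, which is a true inverse only for an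
invertible map; the chart domain condition supplies invertibility. -/
theorem coordDeriv_coordVector
    (hφ : φ ∈ IsManifold.maximalAtlas (𝓡 n) ∞ Q) (hx : HigherTangent.base x ∈ φ.source)
    (j : Fin (r + 1)) (i : Fin n) :
    coordDeriv φ x (coordVector φ x j i) =
      Pi.single j (EuclideanSpace.single i (1 : ℝ)) :=
  ContinuousLinearMap.IsInvertible.self_apply_inverse
    (coord_mdifferentiable_invertible φ hφ hx).2 _

theorem coordDifferential_apply
    (hφ : φ ∈ IsManifold.maximalAtlas (𝓡 n) ∞ Q) (hx : HigherTangent.base x ∈ φ.source)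
    (j : Fin (r + 1)) (i : Fin n)
    (w : TangentSpace 𝓘(ℝ, JetModel n r) x) :
    coordDifferential φ x j i w = coordDeriv φ x w j i := by
  let P : JetModel n r →L[ℝ] ℝ := (EuclideanSpace.proj i).comp (ContinuousLinearMap.proj j)
  have hP : MDifferentiableAt 𝓘(ℝ, JetModel n r) 𝓘(ℝ, ℝ) P (HigherTangent.coord φ x) :=
    P.differentiableAt.mdifferentiableAt
  have h := mfderiv_comp x hP (coord_mdifferentiable_invertible φ hφ hx).1
  rw [mfderiv_eq_fderiv, P.fderiv] at h
  exact DFunLike.congr_fun h w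

theorem sum_coordDeriv_smul_coordVector
    (hφ : φ ∈ IsManifold.maximalAtlas (𝓡 n) ∞ Q) (hx : HigherTangent.base x ∈ φ.source)
    (w : TangentSpace 𝓘(ℝ, JetModel n r) x) :
    ∑ j, ∑ i, coordDeriv φ x w j i • coordVector φ x j i = w := by
  refine (coord_mdifferentiable_invertible φ hφ hx).2.bijective.injective ?_
  change coordDeriv φ x _ = coordDeriv φ x w
  simp only [map_sum, map_smul, coordDeriv_coordVector hφ hx]
  exact jetModel_sum_single _

/-- The vectors `∂/∂q` and differentials `dq` are dual bases, so a covector is recovered from its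
momenta. -/
theorem sum_smul_coordDifferential
    (hφ : φ ∈ IsManifold.maximalAtlas (𝓡 n) ∞ Q) (hx : HigherTangent.base x ∈ φ.source)
    (β : CotangentSpace (JetModel n r) x) :
    ∑ j, ∑ i, β (coordVector φ x j i) • coordDifferential φ x j i = β := by
  refine ContinuousLinearMap.ext fun w => ?_
  conv_rhs => rw [← sum_coordDeriv_smul_coordVector hφ hx w]
  simp only [sum_apply, smul_apply, map_sum, map_smul,
    coordDifferential_apply hφ hx, smul_eq_mul]
  exact Finset.sum_congr rfl fun j _ => Finset.sum_congr rfl fun i _ => mul_comm _ _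

end

/-! ### The local expression and its uniqueness. -/

section
variable {n r : ℕ} {Q : Type*} [TopologicalSpace Q] [ChartedSpace (EuclideanSpace ℝ (Fin n)) Q]
  [IsManifold (𝓡 n) ∞ Q] {H : CotangentBundle (JetModel n r) (HigherTangentBundle n r Q) → ℝ}

theorem hasLegendreLocalExpression_lagrangian (hH : IsHyperregularHamiltonian H) :
    HasLegendreLocalExpression hH (hH.lagrangian (hamiltonianVectorField H)) := by
  intro φ hφ q hq v
  have hx : HigherTangent.base ((HigherTangent.chart r φ hφ).symm q) ∈ φ.source :=
    (HigherTangent.chart r φ hφ).map_target hq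
  obtain ⟨β, hβ, -, hL⟩ := hH.exists_fiberDerivInv_eq ((HigherTangent.chart r φ hφ).symm q)
    (∑ j, ∑ i, v j i • coordVector φ ((HigherTangent.chart r φ hφ).symm q) j i)
  have hβ' : hH.fiberDerivInv (tangentOfCoords φ hφ q v) = ⟨_, β⟩ := hβ
  -- The momenta `p̃` rebuild the covector `𝓕H⁻¹(v)`, so `H` is evaluated there; only the pairing `β
  -- u` remains to be expanded.
  have hc : cotangentOfCoords φ hφ q (momentum φ ⟨_, β⟩) = ⟨_, β⟩ :=
    congrArg (Bundle.TotalSpace.mk _) (sum_smul_coordDifferential hφ hx β)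
  intro p
  have hp : p = momentum φ ⟨_, β⟩ := congrArg (momentum φ) hβ'
  rw [hp, hc]
  refine hL.trans ?_
  simp only [map_sum, map_smul, smul_eq_mul, momentum]
  congr 1
  exact Finset.sum_congr rfl fun j _ => Finset.sum_congr rfl fun i _ => mul_comm _ _

/-- Every vector is reached by the chart of `Q` at its base point, so functions with the same local
expressions coincide. -/
theorem exists_tangentOfCoords_eq (v : TangentBundle 𝓘(ℝ, JetModel n r)
    (HigherTangentBundle n r Q)) :
    ∃ (φ : OpenPartialHomeomorph Q (EuclideanSpace ℝ (Fin n)))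
      (hφ : φ ∈ IsManifold.maximalAtlas (𝓡 n) ∞ Q) (q : JetModel n r)
      (w : Fin (r + 1) → Fin n → ℝ), q 0 ∈ φ.target ∧ tangentOfCoords φ hφ q w = v := by
  obtain ⟨x, w⟩ := v
  have hφ : chartAt (EuclideanSpace ℝ (Fin n)) (HigherTangent.base x) ∈
    IsManifold.maximalAtlas (𝓡 n) ∞ Q := IsManifold.chart_mem_maximalAtlas _
  have hx : HigherTangent.base x ∈
    (chartAt (EuclideanSpace ℝ (Fin n)) (HigherTangent.base x)).source := mem_chart_source _ _
  refine ⟨_, hφ, HigherTangent.coord (chartAt _ (HigherTangent.base x)) x,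
    fun j i => coordDeriv (chartAt _ (HigherTangent.base x)) x w j i,
    (HigherTangent.chart r _ hφ).map_source hx, ?_⟩
  have h : (HigherTangent.chart r _ hφ).symm
    (HigherTangent.coord (chartAt _ (HigherTangent.base x)) x) = x :=
    (HigherTangent.chart r _ hφ).left_inv hx
  unfold tangentOfCoords
  rw [h]
  exact congrArg (Bundle.TotalSpace.mk _) (sum_coordDeriv_smul_coordVector hφ hx w)

theorem HasLegendreLocalExpression.unique {hH : IsHyperregularHamiltonian H}
    {L L' : TangentBundle 𝓘(ℝ, JetModel n r) (HigherTangentBundle n r Q) → ℝ}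
    (hL : HasLegendreLocalExpression hH L) (hL' : HasLegendreLocalExpression hH L') : L = L' := by
  funext v
  obtain ⟨φ, hφ, q, w, hq, rfl⟩ := exists_tangentOfCoords_eq v
  exact (hL φ hφ q hq w).trans (hL' φ hφ q hq w).symm

end

end HigherOrderMechanics

end

theorem mainTheorem8 (n k : ℕ) (hk : 1 ≤ k) (Q : Type*) [TopologicalSpace Q] [T2Space Q]
    [SecondCountableTopology Q] [ChartedSpace (EuclideanSpace ℝ (Fin n)) Q]
    [IsManifold (𝓡 n) ∞ Q]
    (H : CotangentBundle (JetModel n (k - 1)) (HigherTangentBundle n (k - 1) Q) → ℝ)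
    (hH : IsHyperregularHamiltonian H) :
    ∃ X : (∀ α : CotangentBundle (JetModel n (k - 1)) (HigherTangentBundle n (k - 1) Q),
        TangentSpace (cotModel (JetModel n (k - 1))) α),
      (IsHamiltonianVectorField H X ∧ ∀ Y, IsHamiltonianVectorField H Y → Y = X) ∧
      IsHyperregularLagrangian (hH.lagrangian X) ∧
      fiberDerivLagrangian (hH.lagrangian X) = hH.fiberDerivInv ∧
      HasLegendreLocalExpression hH (hH.lagrangian X) ∧
      ∀ L, HasLegendreLocalExpression hH L → L = hH.lagrangian X := by
  exact ⟨hamiltonianVectorField H,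
    ⟨isHamiltonianVectorField_hamiltonianVectorField hH.1,
      fun _ hY => hY.eq_hamiltonianVectorField hH.1⟩,
    hH.isHyperregularLagrangian, hH.fiberDerivLagrangian_lagrangian,
    hasLegendreLocalExpression_lagrangian hH,
    fun _ hL => hL.unique (hasLegendreLocalExpression_lagrangian hH)⟩
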